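/- A set system is a finite multiset $H$ of nonempty finite subsets (edges) of $\{1,2,3,\dots\}$. Its vertex set is $V(H)=\bigcup_{E\in H}E$, the degree of a vertex $v$ is the number of edges containing $v$, and the weight of $H$ is $\sum_{E\in H}|E|$ (edges are counted with multiplicity in both). $H$ is normalized if $V(H)=\{1,2,\dots,m\}$ for some $m$. For integers $k,n\ge 1$ let $h''_{k,n}$ be the number of normalized set systems of weight $n$ in which every vertex has degree at most $k$, and let $b_n$ be the $n$-th Bell number, i.e. the number of partitions of $\{1,\dots,n\}$ into nonempty blocks. Let $k\ge 1$ be a fixed integer. The polynomial $\sum_{i=1}^k \frac{x^i}{i!}-1$ has exactly one root $\alpha_k$ in $(0,1]$, and, as $n\to\infty$, $$\left(\frac{\log n}{n}\right)^{k-1}\left(\frac{1}{\alpha_k}\right)^n b_n\ \ll\ h''_{k,n}\ \ll\ \left(\frac{1}{\alpha_k}\right)^n b_n,$$ where $f(n)\ll g(n)$ means $f(n)=O(g(n))$; the implied constants may depend on $k$. -/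

import Mathlib

open Asymptotics

/-- A set system: a finite multiset `H` of nonempty finite subsets (edges) of `{1, 2, …}`. -/
def IsSetSystem (H : Multiset (Finset ℕ)) : Prop :=
  ∀ E ∈ H, E.Nonempty ∧ ∀ v ∈ E, 1 ≤ v

/-- The vertex set `V(H)`, the union of the edges. -/
def vertexSet (H : Multiset (Finset ℕ)) : Finset ℕ := H.sup

/-- The degree of `v`: the number of edges containing `v`, counted with multiplicity. -/
def vertexDegree (H : Multiset (Finset ℕ)) (v : ℕ) : ℕ := H.countP (fun E => v ∈ E)

/-- The weight of `H`: the sum of the sizes of its edges, counted with multiplicity. -/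
def weight (H : Multiset (Finset ℕ)) : ℕ := (H.map Finset.card).sum

/-- `H` is normalized if `V(H) = {1, …, m}` for some `m`. -/
def IsNormalized (H : Multiset (Finset ℕ)) : Prop :=
  ∃ m : ℕ, vertexSet H = Finset.Icc 1 m

/-- The normalized set systems with weight `n` and maximum vertex degree at most `k`. -/
def normalizedSystems (k n : ℕ) : Set (Multiset (Finset ℕ)) :=
  {H | IsSetSystem H ∧ IsNormalized H ∧ weight H = n ∧
    ∀ v ∈ vertexSet H, vertexDegree H v ≤ k}

theorem normalizedSystems_finite (k n : ℕ) : (normalizedSystems k n).Finite := by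
  classical
  apply (Multiset.finite_toSet (Multiset.powerset
    (n • (Finset.powerset (Finset.Icc 1 n)).val))).subset
  rintro H ⟨hs, ⟨m, hm⟩, hw, -⟩
  simp only [Set.mem_ofPred_eq, Multiset.mem_powerset]
  have hcard : ∀ H : Multiset (Finset ℕ), (vertexSet H).card ≤ weight H := by
    intro H
    induction H using Multiset.induction_on with
    | empty => simp [vertexSet, weight]
    | cons E H ih =>
      simp only [vertexSet, weight, Multiset.sup_cons, Multiset.map_cons,
        Multiset.sum_cons] at ih ⊢
      exact (Finset.card_union_le _ _).trans (by omega)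
  have hmn : m ≤ n := by
    have := hcard H
    rw [hm, hw, Nat.card_Icc] at this
    omega
  rw [Multiset.le_iff_count]
  intro E
  by_cases hE : E ∈ H
  · have hsub : E ⊆ Finset.Icc 1 n :=
      (Multiset.le_sup hE).trans (hm.le.trans (Finset.Icc_subset_Icc_right hmn))
    have h1 : Multiset.count E (Finset.powerset (Finset.Icc 1 n)).val = 1 :=
      Multiset.count_eq_one_of_mem (Finset.nodup _) (Finset.mem_powerset.2 hsub)
    have h2 : H.card ≤ weight H := by
      have : (H.map (fun _ => 1)).sum ≤ (H.map Finset.card).sum :=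
        Multiset.sum_map_le_sum_map _ _ fun E hE => Finset.card_pos.2 (hs E hE).1
      simpa [weight] using this
    rw [Multiset.count_nsmul, h1]
    have := Multiset.count_le_card E H
    omega
  · rw [Multiset.count_eq_zero_of_notMem hE]
    exact Nat.zero_le _

/-- `h''_{k,n}`: the number of normalized set systems with weight `n` and maximum vertex degree
at most `k`. -/
noncomputable def numSystems (k n : ℕ) : ℕ := (normalizedSystems k n).ncard

/-- The `n`-th Bell number: the number of partitions of `{1, …, n}` into nonempty blocks. -/
noncomputable def bellNumber (n : ℕ) : ℕ := Nat.card (Finpartition (Finset.Icc 1 n))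

/-! Fix degrees `d` on `m` vertices with sum `n`. Families of `N` labelled, possibly empty edges
with these degrees number `∏ C(N, d v)`. A system with `e` edges arises from at most
`N(N-1)⋯(N-e+1)` families, with equality if no edge repeats. Since `∑_N N(N-1)⋯(N-e+1)/N!` is
Euler's number whatever `e` is, `∑_N ∏ C(N, d v)/N!` lies between `exp 1` times the number of
systems without repeated edges and `exp 1` times the number of all systems (`card_nodup_le_tsum`,
`tsum_prod_choose_le`). For `d = 1` the two agree, which is Dobiński's formula `∑ N^n/N! = exp 1 *
b_n`.

As `C(N, d)` is roughly `N^d/d!`, about `b_n / ∏ (d v)!` systems have degrees `d`. Summing over `d`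
leaves `b_n` times the sum of `∏ 1/dᵢ!` over compositions of `n` with parts at most `k`; its linear
recurrence makes it of order `(1/α)^n`.

Upper bound: write a system as `S + 2T` with `S` free of repetitions. The choices of `T` of weight
`w` cost a factor `(K n)^w` but lower the Dobiński exponent by `2w`, and the total stays `O(b_n)`
(`sum_pow_mul_dobinski_le`).

Lower bound: `d! C(N, d) ≥ (N-k+1)^d` for `d ≤ k`. The shift by `k-1` costs `(n / log n)^(k-1)`,
because the Dobiński series is carried by `N ≤ 2n / log n` up to a factor 2
(`dobinski_le_tsum_shift`). -/

/-! ### Labelled incidence families with prescribed degrees. -/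

section Incidence

variable {V : Type*} [Fintype V] [DecidableEq V]

/-- The set systems on the vertex type `V` in which each vertex `v` has degree `d v`. -/
def degreeSystems (d : V → ℕ) : Set (Multiset (Finset V)) :=
  {H | (∀ E ∈ H, E.Nonempty) ∧ ∀ v, H.countP (fun E => v ∈ E) = d v}

/-- The multiset of nonempty values of a finite family of finsets. -/
def nonemptyValues {N : ℕ} (g : Fin N → Finset V) : Multiset (Finset V) :=
  (Finset.univ.val.map g).filter Finset.Nonempty

omit [Fintype V] in
theorem countP_nonemptyValues {N : ℕ} (g : Fin N → Finset V) (v : V) :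
    (nonemptyValues g).countP (fun E => v ∈ E) = (Finset.univ.filter fun j => v ∈ g j).card := by
  rw [nonemptyValues, Multiset.countP_filter, Multiset.countP_map]
  rw [Finset.card_def, Finset.filter_val]
  congr 1
  apply Multiset.filter_congr
  intro j _
  exact ⟨fun h => h.1, fun h => ⟨h, _, h⟩⟩

omit [Fintype V] in
theorem count_nonemptyValues {N : ℕ} (g : Fin N → Finset V) {b : Finset V} (hb : b.Nonempty) :
    (nonemptyValues g).count b = Fintype.card {j // g j = b} := by
  rw [nonemptyValues, Multiset.count_filter_of_pos hb, Multiset.count_map, Fintype.card_subtype,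
    Finset.card_def, Finset.filter_val]
  congr 1
  apply Multiset.filter_congr
  intro j _
  exact eq_comm

omit [Fintype V] [DecidableEq V] in
theorem exists_enumeration (H : Multiset (Finset V)) :
    ∃ h : Fin H.card → Finset V, Finset.univ.val.map h = H := by
  induction H using Quotient.inductionOn with
  | _ l =>
    refine ⟨l.get, ?_⟩
    change Multiset.map l.get (Finset.univ : Finset (Fin l.length)).val = (l : Multiset (Finset V))
    rw [Fin.univ_val_map, List.ofFn_get]

/-- Transpose the incidence matrix: each vertex independently chooses which `d v` of the `N`
positions contain it. -/
theorem card_incidence (N : ℕ) (d : V → ℕ) :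
    (Finset.univ.filter fun g : Fin N → Finset V =>
      ∀ v, (Finset.univ.filter fun j => v ∈ g j).card = d v).card = ∏ v, N.choose (d v) := by
  have h : ∏ v, N.choose (d v) =
      (Fintype.piFinset fun v => Finset.powersetCard (d v) (Finset.univ : Finset (Fin N))).card := by
    simp [Fintype.card_piFinset]
  rw [h]
  refine Finset.card_bij' (fun g _ v => Finset.univ.filter fun j => v ∈ g j)
    (fun c _ j => Finset.univ.filter fun v => j ∈ c v) ?_ ?_ ?_ ?_
  · intro g hg
    simpa [Fintype.mem_piFinset, Finset.mem_powersetCard] using hg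
  · intro c hc
    simpa [Fintype.mem_piFinset, Finset.mem_powersetCard] using hc
  · intro g _
    ext; simp
  · intro c _
    ext; simp

/-- Enumerate `H` by `h`. Every `g` in the fibre takes each nonempty value as often as `h` does, so
matching positions value by value exhibits `g` as `h` placed along an injection and padded with `∅`.
-/
theorem card_nonemptyValues_fiber_le (N : ℕ) (H : Multiset (Finset V))
    (hH : ∀ E ∈ H, E.Nonempty) :
    (Finset.univ.filter fun g : Fin N → Finset V => nonemptyValues g = H).card ≤
      N.descFactorial H.card := by
  obtain ⟨h, hh⟩ := exists_enumeration H
  have hne : ∀ i, (h i).Nonempty := fun i => hH _ (hh ▸ Multiset.mem_map_of_mem h (Finset.mem_univ i))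
  have hcard : N.descFactorial H.card = Fintype.card (Fin H.card ↪ Fin N) := by
    simp [Fintype.card_embedding_eq]
  rw [hcard, ← Finset.card_univ]
  refine Finset.card_le_card_of_surjOn (fun φ => Function.extend φ h (fun _ => ∅)) ?_
  intro g hg
  have hg : nonemptyValues g = H := by simpa using hg
  have hfil : nonemptyValues h = H := by
    rw [nonemptyValues, hh]; exact Multiset.filter_eq_self.2 hH
  have heq : ∀ b : Finset V, b.Nonempty → Nonempty ({i // h i = b} ≃ {j // g j = b}) := by
    intro b hb
    rw [← Fintype.card_eq, ← count_nonemptyValues h hb, ← count_nonemptyValues g hb, hg, hfil]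
  have e : ∀ b : Finset V, b.Nonempty → ({i // h i = b} ≃ {j // g j = b}) :=
    fun b hb => Classical.choice (heq b hb)
  have hφ : ∀ i, g (e (h i) (hne i) ⟨i, rfl⟩).1 = h i := fun i => (e (h i) (hne i) ⟨i, rfl⟩).2
  have key : ∀ b hb i i' (hi : h i = b) (hi' : h i' = b),
      (e b hb ⟨i, hi⟩).1 = (e b hb ⟨i', hi'⟩).1 → i = i' := by
    intro b hb i i' hi hi' heq
    have := (e b hb).injective (Subtype.ext heq)
    exact congrArg Subtype.val this
  -- The matching depends on the value `h i`; this moves it to a common `b`, where injectivity and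
  -- surjectivity of a single bijection apply.
  have key2 : ∀ b hb i (hi : h i = b), (e (h i) (hne i) ⟨i, rfl⟩).1 = (e b hb ⟨i, hi⟩).1 := by
    intro b hb i hi
    subst hi
    rfl
  let φ : Fin H.card ↪ Fin N := ⟨fun i => (e (h i) (hne i) ⟨i, rfl⟩).1, by
    intro i i' hii
    have hii' : (e (h i) (hne i) ⟨i, rfl⟩).1 = (e (h i') (hne i') ⟨i', rfl⟩).1 := hii
    have h1 : h i = h i' := by rw [← hφ i, ← hφ i', hii']
    rw [key2 (h i') (hne i') i h1] at hii'
    exact key _ _ _ _ _ _ hii'⟩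
  refine ⟨φ, by simp, ?_⟩
  funext j
  by_cases hj : ∃ i, φ i = j
  · obtain ⟨i, rfl⟩ := hj
    simp only [φ.injective.extend_apply]
    exact (hφ i).symm
  · simp only [Function.extend_apply' _ _ _ hj]
    by_contra hne'
    have hb : (g j).Nonempty := Finset.nonempty_iff_ne_empty.2 (Ne.symm hne')
    obtain ⟨⟨i, hi⟩, hij⟩ := (e (g j) hb).surjective ⟨j, rfl⟩
    refine hj ⟨i, ?_⟩
    change (e (h i) (hne i) ⟨i, rfl⟩).1 = j
    rw [key2 (g j) hb i hi, hij]

omit [Fintype V] [DecidableEq V] in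
theorem nonemptyValues_extend {N e : ℕ} (φ : Fin e ↪ Fin N) (h : Fin e → Finset V)
    (hne : ∀ i, (h i).Nonempty) :
    nonemptyValues (Function.extend φ h (fun _ => ∅)) = Finset.univ.val.map h := by
  have h1 : (Finset.univ.filter fun j => (Function.extend φ h (fun _ => ∅) j).Nonempty) =
      Finset.univ.map φ := by
    ext j
    by_cases hj : ∃ i, φ i = j
    · obtain ⟨i, rfl⟩ := hj
      simp [φ.injective.extend_apply, hne]
    · rw [Finset.mem_filter, Function.extend_apply' _ _ _ hj]
      simpa using hj
  rw [nonemptyValues, Multiset.filter_map]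
  have h2 : Multiset.filter (Finset.Nonempty ∘ Function.extend φ h (fun _ => ∅))
      (Finset.univ : Finset (Fin N)).val = (Finset.univ.map φ).val := by
    rw [← h1]; rfl
  rw [h2, Finset.map_val, Multiset.map_map]
  exact Multiset.map_congr rfl fun i _ => φ.injective.extend_apply _ _ _

/-- When the edges are distinct, the padded family determines where each edge was placed, so
different injections give different families. -/
theorem descFactorial_le_card_nonemptyValues_fiber (N : ℕ) (H : Multiset (Finset V))
    (hH : ∀ E ∈ H, E.Nonempty) (hnd : H.Nodup) :
    N.descFactorial H.card ≤
      (Finset.univ.filter fun g : Fin N → Finset V => nonemptyValues g = H).card := by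
  obtain ⟨h, hh⟩ := exists_enumeration H
  have hne : ∀ i, (h i).Nonempty := fun i => hH _ (hh ▸ Multiset.mem_map_of_mem h (Finset.mem_univ i))
  have hinj : Function.Injective h := by
    intro i j hij
    rw [← hh] at hnd
    exact Multiset.inj_on_of_nodup_map hnd i (Finset.mem_univ i) j (Finset.mem_univ j) hij
  have hcard : N.descFactorial H.card = Fintype.card (Fin H.card ↪ Fin N) := by
    simp [Fintype.card_embedding_eq]
  rw [hcard, ← Finset.card_univ]
  refine Finset.card_le_card_of_injOn (fun φ => Function.extend φ h (fun _ => ∅)) ?_ ?_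
  · intro φ _
    simpa using (nonemptyValues_extend φ h hne).trans hh
  · intro φ _ ψ _ hφψ
    ext1 i
    have h1 : Function.extend φ h (fun _ => ∅) (φ i) = Function.extend ψ h (fun _ => ∅) (φ i) :=
      congrFun hφψ _
    rw [φ.injective.extend_apply] at h1
    by_cases hj : ∃ i', ψ i' = φ i
    · obtain ⟨i', hi'⟩ := hj
      rw [← hi', ψ.injective.extend_apply] at h1
      rw [← hi', hinj h1]
    · rw [Function.extend_apply' _ _ _ hj] at h1
      exact absurd (h1 ▸ hne i) Finset.not_nonempty_empty

theorem sum_degree (H : Multiset (Finset V)) :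
    ∑ v, H.countP (fun E => v ∈ E) = (H.map Finset.card).sum := by
  induction H using Multiset.induction_on with
  | empty => simp
  | cons E H ih =>
    simp only [Multiset.countP_cons, Finset.sum_add_distrib, Multiset.map_cons, Multiset.sum_cons,
      ih, Finset.sum_boole, Nat.cast_id, Finset.filter_univ_mem]
    omega

theorem card_le_sum_degree (H : Multiset (Finset V)) (hH : ∀ E ∈ H, E.Nonempty) :
    H.card ≤ ∑ v, H.countP (fun E => v ∈ E) := by
  rw [sum_degree]
  simpa using Multiset.sum_map_le_sum_map (fun _ => 1) Finset.card fun E hE => (hH E hE).card_pos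

theorem degreeSystems_finite (d : V → ℕ) : (degreeSystems d).Finite := by
  refine (Set.finite_range (fun g : Fin (∑ v, d v) → Finset V => nonemptyValues g)).subset ?_
  rintro H ⟨hH, hd⟩
  obtain ⟨h, hh⟩ := exists_enumeration H
  have hle : H.card ≤ ∑ v, d v := by
    simpa [hd] using card_le_sum_degree H hH
  exact ⟨_, (nonemptyValues_extend (Fin.castLEEmb hle) h
    fun i => hH _ (hh ▸ Multiset.mem_map_of_mem h (Finset.mem_univ i))).trans hh⟩

theorem prod_choose_le_sum (N : ℕ) (d : V → ℕ) :
    ∏ v, N.choose (d v) ≤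
      ∑ H ∈ (degreeSystems_finite d).toFinset, N.descFactorial H.card := by
  rw [← card_incidence, Finset.card_eq_sum_card_fiberwise (f := nonemptyValues)
    (t := (degreeSystems_finite d).toFinset)]
  · refine Finset.sum_le_sum fun H hH => ?_
    rw [Set.Finite.mem_toFinset] at hH
    refine le_trans (Finset.card_le_card ?_) (card_nonemptyValues_fiber_le N H hH.1)
    intro g hg
    simp only [Finset.mem_filter] at hg ⊢
    exact ⟨Finset.mem_univ _, hg.2⟩
  · intro g hg
    simp only [Finset.coe_filter, Finset.mem_univ, true_and, Set.mem_ofPred_eq] at hg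
    rw [Set.Finite.coe_toFinset]
    refine ⟨fun E hE => (Multiset.mem_filter.1 hE).2, fun v => ?_⟩
    rw [countP_nonemptyValues, hg]

theorem sum_descFactorial_le_prod_choose (N : ℕ) (d : V → ℕ) (s : Finset (Multiset (Finset V)))
    (hs : ∀ H ∈ s, H ∈ degreeSystems d ∧ H.Nodup) :
    ∑ H ∈ s, N.descFactorial H.card ≤ ∏ v, N.choose (d v) := by
  rw [← card_incidence]
  refine le_trans (Finset.sum_le_sum fun H hH =>
    descFactorial_le_card_nonemptyValues_fiber N H (hs H hH).1.1 (hs H hH).2) ?_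
  rw [← Finset.card_biUnion]
  · refine Finset.card_le_card fun g hg => ?_
    simp only [Finset.mem_biUnion, Finset.mem_filter, Finset.mem_univ, true_and] at hg ⊢
    obtain ⟨H, hH, rfl⟩ := hg
    intro v
    rw [← countP_nonemptyValues, (hs _ hH).1.2 v]
  · intro H _ H' _ hne
    rw [Function.onFun, Finset.disjoint_left]
    intro g hg hg'
    simp only [Finset.mem_filter] at hg hg'
    exact hne (hg.2.symm.trans hg'.2)

end Incidence

/-! ### Dobiński-type series. -/

/-- Terms with `N < e` vanish, and `N = M + e` contributes `1 / M!`. The value does not depend on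
`e`, so systems are counted regardless of their number of edges. -/
theorem hasSum_descFactorial_div_factorial (e : ℕ) :
    HasSum (fun N : ℕ => (N.descFactorial e : ℝ) / (N.factorial : ℝ)) (Real.exp 1) := by
  have hinj : Function.Injective (fun M : ℕ => M + e) := add_left_injective e
  rw [← hinj.hasSum_iff]
  · have h := NormedSpace.expSeries_div_hasSum_exp (1 : ℝ)
    rw [← Real.exp_eq_exp_ℝ] at h
    refine Eq.mpr (congrArg (fun f => HasSum f (Real.exp 1)) (funext fun M => ?_)) h
    have h1 := Nat.factorial_mul_descFactorial (Nat.le_add_left e M)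
    rw [Nat.add_sub_cancel] at h1
    have h2 : ((M + e).factorial : ℝ) ≠ 0 := by positivity
    have h3 : (M.factorial : ℝ) ≠ 0 := by positivity
    simp only [Function.comp_apply, one_pow]
    rw [div_eq_div_iff h2 h3, one_mul, ← h1]
    push_cast
    ring
  · intro N hN
    have : N < e := by
      by_contra hlt
      exact hN ⟨N - e, by simp; omega⟩
    simp [Nat.descFactorial_of_lt this]

section Dobinski

variable {V : Type*} [Fintype V] [DecidableEq V]

theorem summable_prod_choose (d : V → ℕ) :
    Summable fun N : ℕ => ((∏ v, N.choose (d v) : ℕ) : ℝ) / (N.factorial : ℝ) := by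
  refine Summable.of_nonneg_of_le (fun _ => by positivity) (fun N => ?_)
    (summable_sum (s := (degreeSystems_finite d).toFinset)
      fun H _ => (hasSum_descFactorial_div_factorial H.card).summable)
  rw [← Finset.sum_div]
  gcongr
  exact_mod_cast prod_choose_le_sum N d

theorem tsum_prod_choose_le (d : V → ℕ) :
    ∑' N : ℕ, ((∏ v, N.choose (d v) : ℕ) : ℝ) / (N.factorial : ℝ) ≤
      Real.exp 1 * (degreeSystems d).ncard := by
  have h := hasSum_sum (s := (degreeSystems_finite d).toFinset)
      fun H _ => (hasSum_descFactorial_div_factorial H.card)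
  rw [Finset.sum_const, ← Set.ncard_eq_toFinset_card _ (degreeSystems_finite d), nsmul_eq_mul,
    mul_comm] at h
  rw [← h.tsum_eq]
  refine (summable_prod_choose d).tsum_le_tsum (fun N => ?_) h.summable
  rw [← Finset.sum_div]
  gcongr
  exact_mod_cast prod_choose_le_sum N d

theorem card_nodup_le_tsum (d : V → ℕ) (s : Finset (Multiset (Finset V)))
    (hs : ∀ H ∈ s, H ∈ degreeSystems d ∧ H.Nodup) :
    Real.exp 1 * s.card ≤ ∑' N : ℕ, ((∏ v, N.choose (d v) : ℕ) : ℝ) / (N.factorial : ℝ) := by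
  have h := hasSum_sum (s := s) fun H _ => (hasSum_descFactorial_div_factorial H.card)
  rw [Finset.sum_const, nsmul_eq_mul, mul_comm] at h
  rw [← h.tsum_eq]
  refine h.summable.tsum_le_tsum (fun N => ?_) (summable_prod_choose d)
  rw [← Finset.sum_div]
  gcongr
  exact_mod_cast sum_descFactorial_le_prod_choose N d s hs

omit [Fintype V] in
theorem nodup_of_degree_le_one (H : Multiset (Finset V)) (hH : ∀ E ∈ H, E.Nonempty)
    (hd : ∀ v, H.countP (fun E => v ∈ E) ≤ 1) : H.Nodup := by
  rw [Multiset.nodup_iff_count_le_one]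
  intro E
  by_cases hE : E ∈ H
  · obtain ⟨v, hv⟩ := hH E hE
    refine le_trans ?_ (hd v)
    rw [Multiset.count, Multiset.countP_eq_card_filter, Multiset.countP_eq_card_filter]
    refine Multiset.card_le_card (Multiset.monotone_filter_right _ ?_)
    rintro F rfl
    exact hv
  · rw [Multiset.count_eq_zero_of_notMem hE]
    exact Nat.zero_le _

end Dobinski

/-- The Dobiński series `∑ N ^ n / N!`. -/
noncomputable def dobinski (n : ℕ) : ℝ := ∑' N : ℕ, (N : ℝ) ^ n / (N.factorial : ℝ)

theorem summable_dobinski (n : ℕ) : Summable fun N : ℕ => (N : ℝ) ^ n / (N.factorial : ℝ) := by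
  simpa using summable_prod_choose (fun _ : Fin n => 1)

theorem dobinski_nonneg (n : ℕ) : 0 ≤ dobinski n := tsum_nonneg fun N => by positivity

/-- With all degrees 1 no edge can repeat, so the lower and upper estimates coincide. -/
theorem dobinski_eq_ncard (n : ℕ) :
    dobinski n = Real.exp 1 * (degreeSystems fun _ : Fin n => 1).ncard := by
  have h1 := tsum_prod_choose_le (fun _ : Fin n => 1)
  have h2 := card_nodup_le_tsum (fun _ : Fin n => 1) (degreeSystems_finite _).toFinset
    (fun H hH => by
      rw [Set.Finite.mem_toFinset] at hH
      exact ⟨hH, nodup_of_degree_le_one H hH.1 fun v => (hH.2 v).le⟩)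
  rw [← Set.ncard_eq_toFinset_card _ (degreeSystems_finite _)] at h2
  simp only [Nat.choose_one_right, Finset.prod_const, Finset.card_univ, Fintype.card_fin,
    Nat.cast_pow] at h1 h2
  exact le_antisymm h1 h2

/-! ### Splitting off doubled edges and coding them by words. -/

section Words

variable {V : Type*} [DecidableEq V]

/-- Read a word as a list of edges; the flag marks the letters that open a new edge. -/
def wordEdges : List (V × Bool) → List (Finset V)
  | [] => []
  | (v, true) :: l => {v} :: wordEdges l
  | (v, false) :: l => (wordEdges l).modifyHead (insert v)

/-- Spell each edge as a list of its vertices, flagging only the last. Hence at most `(2|V|)^w`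
multisets of nonempty edges have weight `w`. -/
theorem exists_wordEdges_eq (L : List (Finset V)) (hL : ∀ E ∈ L, E.Nonempty) :
    ∃ l : List (V × Bool), l.length = (L.map Finset.card).sum ∧ wordEdges l = L := by
  induction L with
  | nil => exact ⟨[], rfl, rfl⟩
  | cons E L ih =>
    obtain ⟨l, hl, hw⟩ := ih fun F hF => hL F (List.mem_cons_of_mem _ hF)
    have hE := hL E List.mem_cons_self
    clear hL ih
    induction hE using Finset.Nonempty.cons_induction with
    | singleton v => exact ⟨(v, true) :: l, by simp [hl, add_comm], by simp [wordEdges, hw]⟩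
    | cons v s hv _ ih =>
      obtain ⟨l', hl', hw'⟩ := ih
      refine ⟨(v, false) :: l', ?_, by simp [wordEdges, hw']⟩
      simp only [List.length_cons, hl', List.map_cons, List.sum_cons, Finset.card_cons]
      omega

/-- `S` collects the edges of odd multiplicity. -/
theorem exists_finset_add_two_nsmul (H : Multiset (Finset V)) :
    ∃ (S : Finset (Finset V)) (T : Multiset (Finset V)), H = S.val + 2 • T := by
  induction H using Multiset.induction_on with
  | empty => exact ⟨∅, 0, by simp⟩
  | cons E H ih =>
    obtain ⟨S, T, rfl⟩ := ih
    by_cases hE : E ∈ S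
    · refine ⟨S.erase E, E ::ₘ T, ?_⟩
      have h : S.val = E ::ₘ (S.erase E).val := by
        rw [Finset.erase_val, Multiset.cons_erase hE]
      rw [h, two_nsmul, two_nsmul]
      simp only [Multiset.cons_add, Multiset.add_cons]
    · refine ⟨insert E S, T, ?_⟩
      rw [Finset.insert_val_of_notMem hE, Multiset.cons_add]

end Words

/-! ### Upper bound for a fixed degree sequence. -/

section Upper

variable {V : Type*} [Fintype V] [DecidableEq V]

open Classical in
/-- The simple parts that complete `2 • T` to a set system with degrees `d`. -/
noncomputable def simpleParts (d : V → ℕ) (T : Multiset (Finset V)) : Finset (Finset (Finset V)) :=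
  Finset.univ.filter fun S => S.val + 2 • T ∈ degreeSystems d

theorem mem_simpleParts {d : V → ℕ} {T : Multiset (Finset V)} {S : Finset (Finset V)} :
    S ∈ simpleParts d T ↔ S.val + 2 • T ∈ degreeSystems d := by
  simp [simpleParts]

/-- With `t` the degrees of `T`, the parts `S` have degrees `d - 2t` and no repeated edge, so the
series bound applies. Termwise, `d! C(N, d-2t)` is a product of falling factorials of `d` and `N`,
of lengths `2t` and `d-2t`, hence at most `k^(2t) N^(d-2t)`. -/
theorem card_simpleParts_le {k : ℕ} (d : V → ℕ) (hd : ∀ v, d v ≤ k) (T : Multiset (Finset V)) :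
    Real.exp 1 * (simpleParts d T).card * ∏ v, ((d v).factorial : ℝ) ≤
      (k : ℝ) ^ (2 * (T.map Finset.card).sum) *
        dobinski (∑ v, d v - 2 * (T.map Finset.card).sum) := by
  -- A witness `S₀` forces `2t ≤ d`, making the natural-number subtractions below exact.
  rcases (simpleParts d T).eq_empty_or_nonempty with h0 | ⟨S₀, hS₀⟩
  · rw [h0]
    simpa using mul_nonneg (by positivity) (dobinski_nonneg _)
  set t : V → ℕ := fun v => T.countP (fun E => v ∈ E) with ht
  have hcount : ∀ S ∈ simpleParts d T, ∀ v, S.val.countP (fun E => v ∈ E) + 2 * t v = d v := by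
    intro S hS v
    rw [mem_simpleParts] at hS
    rw [← hS.2 v, Multiset.countP_add, Multiset.countP_nsmul]
  have htd : ∀ v, 2 * t v ≤ d v := fun v => by have := hcount S₀ hS₀ v; omega
  have hsum : ∑ v, (d v - 2 * t v) = ∑ v, d v - 2 * (T.map Finset.card).sum := by
    rw [Finset.sum_tsub_distrib _ fun v _ => htd v, ← Finset.mul_sum, sum_degree]
  have h1 := card_nodup_le_tsum (fun v => d v - 2 * t v)
    ((simpleParts d T).map ⟨Finset.val, Finset.val_injective⟩) (fun H hH => by
      obtain ⟨S, hS, rfl⟩ := Finset.mem_map.1 hH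
      refine ⟨⟨fun E hE => ?_, fun v => ?_⟩, S.nodup⟩
      · rw [mem_simpleParts] at hS
        exact hS.1 E (Multiset.mem_add.2 (Or.inl hE))
      · have := hcount S hS v
        simp only [Function.Embedding.coeFn_mk]
        omega)
  rw [Finset.card_map] at h1
  refine (mul_le_mul_of_nonneg_right h1 (by positivity)).trans ?_
  rw [← hsum, ← sum_degree, dobinski, ← tsum_mul_right, ← tsum_mul_left]
  refine Summable.tsum_le_tsum (fun N => ?_) ((summable_prod_choose _).mul_right _)
    ((summable_dobinski _).mul_left _)
  rw [div_mul_eq_mul_div, ← mul_div_assoc]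
  refine div_le_div_of_nonneg_right ?_ (by positivity)
  rw [Finset.mul_sum, ← Finset.prod_pow_eq_pow_sum, ← Finset.prod_pow_eq_pow_sum, Nat.cast_prod,
    ← Finset.prod_mul_distrib, ← Finset.prod_mul_distrib]
  refine Finset.prod_le_prod (fun v _ => by positivity) fun v _ => ?_
  norm_cast
  rw [← Nat.factorial_mul_descFactorial (htd v), ← mul_assoc, mul_comm (N.choose _),
    ← Nat.descFactorial_eq_factorial_mul_choose, mul_comm]
  exact Nat.mul_le_mul ((Nat.descFactorial_le_pow _ _).trans (Nat.pow_le_pow_left (hd v) _))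
    (Nat.descFactorial_le_pow _ _)

-- Union bound over the words spelling `T`; the condition discards words whose decoded edges have
-- total size other than the length, as when a letter repeats within an edge.
open Classical in
theorem ncard_degreeSystems_le (d : V → ℕ) :
    (degreeSystems d).ncard ≤ ∑ w ∈ Finset.range ((∑ v, d v) / 2 + 1), ∑ l : Fin w → V × Bool,
      if ((wordEdges (List.ofFn l)).map Finset.card).sum = w
      then (simpleParts d (wordEdges (List.ofFn l) : List (Finset V))).card else 0 := by
  rw [Set.ncard_eq_toFinset_card _ (degreeSystems_finite d)]
  have hsub : (degreeSystems_finite d).toFinset ⊆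
      (Finset.range ((∑ v, d v) / 2 + 1)).biUnion fun w =>
        (Finset.univ : Finset (Fin w → V × Bool)).biUnion fun l =>
          if ((wordEdges (List.ofFn l)).map Finset.card).sum = w then
            (simpleParts d (wordEdges (List.ofFn l) : List (Finset V))).image
              (fun S => S.val + 2 • ((wordEdges (List.ofFn l) : List (Finset V)) :
                Multiset (Finset V))) else ∅ := by
    intro H hH
    rw [Set.Finite.mem_toFinset] at hH
    obtain ⟨S, T, rfl⟩ := exists_finset_add_two_nsmul H
    have hT : ∀ E ∈ T.toList, E.Nonempty := fun E hE => hH.1 E (by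
      rw [Multiset.mem_toList] at hE
      simp [hE])
    obtain ⟨l, hl, hlT⟩ := exists_wordEdges_eq T.toList hT
    have hlT' : ((wordEdges l : List (Finset V)) : Multiset (Finset V)) = T := by
      rw [hlT, Multiset.coe_toList]
    have hw : 2 * l.length ≤ ∑ v, d v := by
      have h1 : ∑ v, (S.val + 2 • T).countP (fun E => v ∈ E) = ∑ v, d v :=
        Finset.sum_congr rfl fun v _ => hH.2 v
      rw [sum_degree, Multiset.map_add, Multiset.sum_add, Multiset.map_nsmul, Multiset.sum_nsmul,
        ← hlT', Multiset.map_coe, Multiset.sum_coe, hlT, ← hl, smul_eq_mul] at h1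
      omega
    simp only [Finset.mem_biUnion, Finset.mem_range, Finset.mem_univ, true_and]
    refine ⟨l.length, by omega, l.get, ?_⟩
    rw [List.ofFn_get, if_pos (by rw [hlT, hl]), Finset.mem_image]
    refine ⟨S, ?_, by rw [hlT']⟩
    rwa [mem_simpleParts, hlT']
  refine (Finset.card_le_card hsub).trans (Finset.card_biUnion_le.trans ?_)
  refine Finset.sum_le_sum fun w _ => Finset.card_biUnion_le.trans (Finset.sum_le_sum fun l _ => ?_)
  split_ifs
  · exact Finset.card_image_le
  · simp

theorem ncard_degreeSystems_mul_prod_factorial_le {k : ℕ} (d : V → ℕ) (hd : ∀ v, d v ≤ k) :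
    Real.exp 1 * (degreeSystems d).ncard * ∏ v, ((d v).factorial : ℝ) ≤
      ∑ w ∈ Finset.range ((∑ v, d v) / 2 + 1),
        (2 * (k : ℝ) ^ 2 * Fintype.card V) ^ w * dobinski (∑ v, d v - 2 * w) := by
  classical
  have h := ncard_degreeSystems_le d
  have h' := (Nat.cast_le (α := ℝ)).2 h
  have hP : 0 < ∏ v, ((d v).factorial : ℝ) := by positivity
  refine (mul_le_mul_of_nonneg_right (mul_le_mul_of_nonneg_left h' (Real.exp_pos 1).le)
    hP.le).trans ?_
  push_cast
  rw [Finset.mul_sum, Finset.sum_mul]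
  refine Finset.sum_le_sum fun w _ => ?_
  rw [Finset.mul_sum, Finset.sum_mul]
  refine (Finset.sum_le_sum (g := fun _ => (k : ℝ) ^ (2 * w) * dobinski (∑ v, d v - 2 * w))
    fun l _ => ?_).trans (le_of_eq ?_)
  · split_ifs with hl
    · have := card_simpleParts_le d hd (wordEdges (List.ofFn l) : List (Finset V))
      rwa [Multiset.map_coe, Multiset.sum_coe, hl] at this
    · simpa using mul_nonneg (by positivity) (dobinski_nonneg _)
  · rw [Finset.sum_const, Finset.card_univ, nsmul_eq_mul]
    simp only [Fintype.card_pi, Fintype.card_prod, Fintype.card_bool, Finset.prod_const,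
      Finset.card_univ, Fintype.card_fin]
    push_cast
    rw [pow_mul, ← mul_assoc, ← mul_pow]
    congr 2
    ring

end Upper

/-! ### Growth of the Dobiński series and absorption of doubled edges. -/

theorem pow_sub_le_dobinski (n N : ℕ) (h : N ≤ n) : (N : ℝ) ^ (n - N) ≤ dobinski n := by
  refine le_trans ?_ ((summable_dobinski n).le_tsum N fun M _ => by positivity)
  rw [le_div_iff₀ (by positivity)]
  calc (N : ℝ) ^ (n - N) * (N.factorial : ℝ) ≤ (N : ℝ) ^ (n - N) * (N : ℝ) ^ N := by
        gcongr
        exact_mod_cast Nat.factorial_le_pow N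
    _ = (N : ℝ) ^ n := by rw [← pow_add, Nat.sub_add_cancel h]

/-- The single term `N = ⌊n/4⌋` suffices: it gives at least `N^(3n/4)`, while `(2Kn)^2 ≤ (16KN)^2 ≤
N^3` once `N ≥ 256 K^2`. Fourth powers clear the roots. -/
theorem sqrt_pow_le_dobinski (K n : ℕ) (hn : 1024 * K ^ 2 + 4 ≤ n) :
    √(2 * K * n) ^ n ≤ dobinski n := by
  set N := n / 4 with hN
  have h1 : 256 * K ^ 2 ≤ N := by omega
  have h2 : n ≤ 8 * N := by omega
  have h3 : N ≤ n := by omega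
  refine le_trans ?_ (pow_sub_le_dobinski n N h3)
  rw [← pow_le_pow_iff_left₀ (by positivity) (by positivity) (by norm_num : (4 : ℕ) ≠ 0),
    ← pow_mul, mul_comm n 4, ← pow_mul, pow_mul]
  have h4 : √(2 * (K : ℝ) * n) ^ 4 = ((2 * K * n) ^ 2 : ℕ) := by
    rw [show 4 = 2 * 2 from rfl, pow_mul, Real.sq_sqrt (by positivity)]
    push_cast
    ring
  rw [h4]
  norm_cast
  calc ((2 * K * n) ^ 2) ^ n ≤ (N ^ 3) ^ n := by
        refine Nat.pow_le_pow_left ?_ n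
        calc (2 * K * n) ^ 2 ≤ (2 * K * (8 * N)) ^ 2 := by gcongr
          _ = (256 * K ^ 2) * N ^ 2 := by ring
          _ ≤ N * N ^ 2 := by gcongr
          _ = N ^ 3 := by ring
    _ = N ^ (3 * n) := by rw [pow_mul]
    _ ≤ N ^ ((n - N) * 4) := Nat.pow_le_pow_right (by omega) (by omega)

/-- With `y = √(2Kn)`, `y^(2w) N^(n-2w)` is at most `N^n` or `y^n` according as `N ≥ y` or `N ≤ y`,
and `y^n` is itself at most the Dobiński sum. The 2 inside `y` leaves a summable factor `2^(-w)`. -/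
theorem sum_pow_mul_dobinski_le (K n : ℕ) (hn : 1024 * K ^ 2 + 4 ≤ n) :
    ∑ w ∈ Finset.range (n / 2 + 1), ((K : ℝ) * n) ^ w * dobinski (n - 2 * w) ≤
      2 * (1 + Real.exp 1) * dobinski n := by
  set y := √(2 * (K : ℝ) * n) with hy
  have hy0 : 0 ≤ y := Real.sqrt_nonneg _
  have hy2 : y ^ 2 = 2 * (K : ℝ) * n := Real.sq_sqrt (by positivity)
  have hexp : HasSum (fun N : ℕ => y ^ n / (N.factorial : ℝ)) (y ^ n * Real.exp 1) := by
    simpa [div_eq_mul_inv] using (hasSum_descFactorial_div_factorial 0).mul_left (y ^ n)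
  have key : ∀ w ∈ Finset.range (n / 2 + 1),
      ((K : ℝ) * n) ^ w * dobinski (n - 2 * w) ≤
        (1 / 2) ^ w * ((1 + Real.exp 1) * dobinski n) := by
    intro w hw
    have hw : 2 * w ≤ n := by rw [Finset.mem_range] at hw; omega
    have h1 : y ^ (2 * w) * dobinski (n - 2 * w) ≤ dobinski n + y ^ n * Real.exp 1 := by
      rw [← hexp.tsum_eq, dobinski, dobinski, ← tsum_mul_left,
        ← (summable_dobinski n).tsum_add hexp.summable]
      refine Summable.tsum_le_tsum (fun N => ?_) ((summable_dobinski _).mul_left _)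
        ((summable_dobinski n).add hexp.summable)
      rw [← mul_div_assoc, ← add_div]
      gcongr
      rcases le_total y N with h | h
      · calc y ^ (2 * w) * (N : ℝ) ^ (n - 2 * w) ≤ (N : ℝ) ^ (2 * w) * (N : ℝ) ^ (n - 2 * w) := by
              gcongr
          _ = (N : ℝ) ^ n := by rw [← pow_add, Nat.add_sub_cancel' hw]
          _ ≤ _ := le_add_of_nonneg_right (by positivity)
      · calc y ^ (2 * w) * (N : ℝ) ^ (n - 2 * w) ≤ y ^ (2 * w) * y ^ (n - 2 * w) := by
              gcongr
          _ = y ^ n := by rw [← pow_add, Nat.add_sub_cancel' hw]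
          _ ≤ _ := le_add_of_nonneg_left (by positivity)
    have h2 : ((K : ℝ) * n) ^ w = (1 / 2) ^ w * y ^ (2 * w) := by
      rw [pow_mul, hy2, ← mul_pow]
      congr 1
      ring
    rw [h2, mul_assoc]
    refine mul_le_mul_of_nonneg_left (h1.trans ?_) (by positivity)
    have := mul_le_mul_of_nonneg_right (sqrt_pow_le_dobinski K n hn) (Real.exp_pos 1).le
    linarith
  refine (Finset.sum_le_sum key).trans ?_
  rw [← Finset.sum_mul, mul_assoc]
  refine mul_le_mul_of_nonneg_right ?_ (mul_nonneg (by positivity) (dobinski_nonneg n))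
  exact sum_geometric_two_le _

/-! ### Truncating and shifting the Dobiński series for the lower bound. -/

/-- The ratio of consecutive terms is `(1 + 1/N)^n / (N+1) ≤ e^(n/N) / (N+1)`; here `e^(n/N) ≤ √n`
and `N ≥ 2√n`. -/
theorem dobinski_term_succ_le {n N : ℕ} (hlog : 0 < Real.log n) (hsqrt : Real.log n ≤ √n)
    (hN : 2 * n / Real.log n ≤ N) :
    ((N + 1 : ℕ) : ℝ) ^ n / ((N + 1).factorial : ℝ) ≤ (N : ℝ) ^ n / (N.factorial : ℝ) * (1 / 2) := by
  have hn : (0 : ℝ) < n := by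
    rcases Nat.eq_zero_or_pos n with rfl | h
    · simp at hlog
    · exact_mod_cast h
  have hNpos : (0 : ℝ) < N := lt_of_lt_of_le (by positivity) hN
  have h1 : 2 * √n ≤ N := by
    refine le_trans ?_ hN
    rw [le_div_iff₀ hlog]
    nlinarith [Real.mul_self_sqrt hn.le, Real.sqrt_nonneg (n : ℝ)]
  have h2 : (n : ℝ) / N ≤ Real.log n / 2 := by
    rw [div_le_iff₀ hlog] at hN
    rw [div_le_div_iff₀ hNpos two_pos]
    linarith
  have h3 : ((N : ℝ) + 1) ^ n ≤ (N : ℝ) ^ n * √n := by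
    have h4 : (N : ℝ) + 1 ≤ N * Real.exp (1 / N) := by
      have := mul_le_mul_of_nonneg_left (Real.add_one_le_exp (1 / (N : ℝ))) hNpos.le
      rw [mul_add, mul_one_div_cancel hNpos.ne'] at this
      linarith
    calc ((N : ℝ) + 1) ^ n ≤ (N * Real.exp (1 / N)) ^ n := by gcongr
      _ = (N : ℝ) ^ n * Real.exp (n / N) := by
        rw [mul_pow, ← Real.exp_nat_mul, mul_one_div]
      _ ≤ (N : ℝ) ^ n * Real.exp (Real.log n / 2) := by gcongr
      _ = (N : ℝ) ^ n * √n := by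
        rw [← Real.log_sqrt hn.le, Real.exp_log (Real.sqrt_pos.2 hn)]
  rw [Nat.factorial_succ, div_mul_div_comm, div_le_div_iff₀ (by positivity) (by positivity)]
  push_cast
  calc ((N : ℝ) + 1) ^ n * (N.factorial * 2) ≤ ((N : ℝ) ^ n * √n) * (N.factorial * 2) := by gcongr
    _ = (N : ℝ) ^ n * N.factorial * (2 * √n) := by ring
    _ ≤ (N : ℝ) ^ n * N.factorial * (N + 1) := by gcongr; linarith
    _ = (N : ℝ) ^ n * 1 * ((N + 1) * N.factorial) := by ring

theorem dobinski_le_two_mul_sum {n J : ℕ} (hlog : 0 < Real.log n) (hsqrt : Real.log n ≤ √n)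
    (hJ : 2 * n / Real.log n ≤ J) :
    dobinski n ≤ 2 * ∑ N ∈ Finset.range (J + 1), (N : ℝ) ^ n / (N.factorial : ℝ) := by
  set a : ℕ → ℝ := fun N => (N : ℝ) ^ n / (N.factorial : ℝ) with ha
  have hs : Summable a := summable_dobinski n
  have ha0 : ∀ N, 0 ≤ a N := fun N => by positivity
  have hgeom : ∀ i, a (i + J) ≤ a J * (1 / 2) ^ i := by
    intro i
    induction i with
    | zero => simp
    | succ i ih =>
      have h := dobinski_term_succ_le (N := i + J) hlog hsqrt
        (hJ.trans (by exact_mod_cast Nat.le_add_left J i))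
      rw [show i + 1 + J = i + J + 1 by ring, pow_succ]
      calc a (i + J + 1) ≤ a (i + J) * (1 / 2) := h
        _ ≤ a J * (1 / 2) ^ i * (1 / 2) := by gcongr
        _ = _ := by ring
  have htail : ∑' i, a (i + J) ≤ a J * 2 := by
    rw [← tsum_geometric_two, ← tsum_mul_left]
    exact ((summable_nat_add_iff J).2 hs).tsum_le_tsum hgeom
      (summable_geometric_two.mul_left _)
  change ∑' N, a N ≤ _
  rw [← hs.sum_add_tsum_nat_add J, Finset.sum_range_succ]
  have : 0 ≤ ∑ N ∈ Finset.range J, a N := Finset.sum_nonneg fun N _ => ha0 N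
  linarith

theorem summable_pow_div_factorial_add (n r : ℕ) :
    Summable fun M : ℕ => (M : ℝ) ^ n / ((M + r).factorial : ℝ) := by
  refine Summable.of_nonneg_of_le (fun _ => by positivity) (fun M => ?_) (summable_dobinski n)
  gcongr
  omega

/-- For `M ≤ J`, replacing `M!` by `(M+r)!` costs at most `(J+r)^r`; the later terms are already
absorbed in the factor 2. -/
theorem dobinski_le_tsum_shift {n r J : ℕ} (hlog : 0 < Real.log n) (hsqrt : Real.log n ≤ √n)
    (hJ : 2 * n / Real.log n ≤ J) :
    dobinski n ≤ 2 * ((J + r : ℕ) : ℝ) ^ r * ∑' M : ℕ, (M : ℝ) ^ n / ((M + r).factorial : ℝ) := by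
  refine (dobinski_le_two_mul_sum hlog hsqrt hJ).trans ?_
  rw [mul_assoc]
  refine mul_le_mul_of_nonneg_left ?_ zero_le_two
  refine le_trans ?_ (mul_le_mul_of_nonneg_left
    ((summable_pow_div_factorial_add n r).sum_le_tsum (Finset.range (J + 1))
      fun M _ => by positivity) (by positivity))
  rw [Finset.mul_sum]
  refine Finset.sum_le_sum fun M hM => ?_
  have hM : M ≤ J := by rw [Finset.mem_range] at hM; omega
  rw [← mul_div_assoc, div_le_div_iff₀ (by positivity) (by positivity)]
  have h : ((M + r).factorial : ℝ) ≤ M.factorial * ((J + r : ℕ) : ℝ) ^ r := by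
    norm_cast
    rw [← Nat.factorial_mul_ascFactorial]
    exact Nat.mul_le_mul_left _ ((Nat.ascFactorial_le_pow_add M r).trans
      (Nat.pow_le_pow_left (by omega) r))
  calc (M : ℝ) ^ n * ((M + r).factorial : ℝ)
      ≤ (M : ℝ) ^ n * (M.factorial * ((J + r : ℕ) : ℝ) ^ r) := by gcongr
    _ = _ := by ring

theorem eventually_log_div_pow_mul_dobinski_le (r : ℕ) :
    ∀ᶠ n : ℕ in Filter.atTop, (Real.log n / n) ^ r * dobinski n ≤
      2 * (3 + r : ℝ) ^ r * ∑' M : ℕ, (M : ℝ) ^ n / ((M + r).factorial : ℝ) := by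
  have h1 : ∀ᶠ n : ℕ in Filter.atTop, Real.log n ≤ √n := by
    have h := (isLittleO_log_rpow_atTop (r := 1 / 2) (by norm_num)).bound (c := 1) one_pos
    have h := tendsto_natCast_atTop_atTop.eventually h
    filter_upwards [h] with n hn
    rw [one_mul, ← Real.sqrt_eq_rpow, Real.norm_of_nonneg (Real.sqrt_nonneg _)] at hn
    exact (le_abs_self _).trans hn
  filter_upwards [h1, Filter.eventually_ge_atTop 2] with n hsqrt hn
  have hn' : (2 : ℝ) ≤ n := by exact_mod_cast hn
  have hlog : 0 < Real.log n := Real.log_pos (by linarith)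
  have hnpos : (0 : ℝ) < n := by linarith
  have hle : Real.log n ≤ n := (Real.log_le_sub_one_of_pos hnpos).trans (by linarith)
  set J := ⌈2 * n / Real.log n⌉₊ with hJ
  have hD := dobinski_le_tsum_shift (r := r) hlog hsqrt (Nat.le_ceil _)
  have hT : 0 ≤ ∑' M : ℕ, (M : ℝ) ^ n / ((M + r).factorial : ℝ) :=
    tsum_nonneg fun M => by positivity
  have hone : 1 ≤ n / Real.log n := (one_le_div hlog).2 hle
  -- The 3 is 2 from `J` plus 1 from rounding up; the 1 and the `r` are absorbed since `n / log n ≥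
  -- 1`.
  have hJr : ((J + r : ℕ) : ℝ) ≤ (3 + r) * (n / Real.log n) := by
    have h2 := (Nat.ceil_lt_add_one (by positivity : 0 ≤ 2 * (n : ℝ) / Real.log n)).le
    push_cast
    have h3 : (r : ℝ) ≤ r * (n / Real.log n) := le_mul_of_one_le_right (by positivity) hone
    rw [← hJ, mul_div_assoc] at h2
    linarith
  calc (Real.log n / n) ^ r * dobinski n
      ≤ (Real.log n / n) ^ r * (2 * ((J + r : ℕ) : ℝ) ^ r * _) := by gcongr
    _ ≤ (Real.log n / n) ^ r * (2 * ((3 + r) * (n / Real.log n)) ^ r * _) := by gcongr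
    _ = (Real.log n / n * (n / Real.log n)) ^ r *
        (2 * (3 + r : ℝ) ^ r * ∑' M : ℕ, (M : ℝ) ^ n / ((M + r).factorial : ℝ)) := by
      rw [mul_pow, mul_pow]
      ring
    _ = _ := by
      rw [div_mul_div_cancel₀ hnpos.ne', div_self hlog.ne', one_pow, one_mul]

/-- Put `N = M + r`. As `d ≤ r + 1`, every factor of `d! C(N, d) = N(N-1)⋯(N-d+1)` is at least `M`.
-/
theorem tsum_shift_le_ncard_degreeSystems {V : Type*} [Fintype V] [DecidableEq V] {r : ℕ}
    (d : V → ℕ) (hd : ∀ v, d v ≤ r + 1) :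
    ∑' M : ℕ, (M : ℝ) ^ (∑ v, d v) / ((M + r).factorial : ℝ) ≤
      Real.exp 1 * (degreeSystems d).ncard * ∏ v, ((d v).factorial : ℝ) := by
  refine le_trans ?_ (mul_le_mul_of_nonneg_right (tsum_prod_choose_le d) (by positivity))
  rw [← tsum_mul_right]
  refine Summable.tsum_le_tsum_of_inj (fun M => M + r) (add_left_injective r)
    (fun _ _ => by positivity) (fun M => ?_) (summable_pow_div_factorial_add _ _)
    ((summable_prod_choose d).mul_right _)
  rw [div_mul_eq_mul_div]
  refine div_le_div_of_nonneg_right ?_ (by positivity)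
  norm_cast
  rw [← Finset.prod_mul_distrib, ← Finset.prod_pow_eq_pow_sum]
  refine Finset.prod_le_prod' fun v _ => ?_
  rw [mul_comm, ← Nat.descFactorial_eq_factorial_mul_choose]
  refine le_trans (Nat.pow_le_pow_left ?_ _) (Nat.pow_sub_le_descFactorial _ _)
  have := hd v
  omega

/-! ### Weighted compositions and the root `α`. -/

section Compositions

open Polynomial

/-- The truncated exponential polynomial `∑_{1 ≤ i ≤ k} X ^ i / i!`. -/
noncomputable def truncExp (k : ℕ) : ℝ[X] :=
  ∑ i ∈ Finset.Icc 1 k, C (1 / (i.factorial : ℝ)) * X ^ i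

theorem coeff_truncExp_pow_succ (k m n : ℕ) :
    (truncExp k ^ (m + 1)).coeff n = ∑ i ∈ Finset.Icc 1 k,
      if i ≤ n then 1 / (i.factorial : ℝ) * (truncExp k ^ m).coeff (n - i) else 0 := by
  rw [pow_succ', truncExp, Finset.sum_mul, Polynomial.finsetSum_coeff]
  refine Finset.sum_congr rfl fun i _ => ?_
  rw [mul_assoc, Polynomial.coeff_C_mul, Polynomial.coeff_X_pow_mul', mul_ite, mul_zero]

theorem coeff_truncExp_pow_of_lt (k : ℕ) {m n : ℕ} (h : n < m) :
    (truncExp k ^ m).coeff n = 0 := by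
  induction m generalizing n with
  | zero => omega
  | succ m ih =>
    rw [coeff_truncExp_pow_succ]
    refine Finset.sum_eq_zero fun i hi => ?_
    rw [Finset.mem_Icc] at hi
    split_ifs with hin
    · rw [ih (by omega), mul_zero]
    · rfl

theorem coeff_truncExp_pow (k m n : ℕ) :
    (truncExp k ^ m).coeff n =
      ∑ d ∈ (Fintype.piFinset fun _ : Fin m => Finset.Icc 1 k).filter (fun d => ∑ v, d v = n),
        (∏ v, ((d v).factorial : ℝ))⁻¹ := by
  have h : truncExp k ^ m = ∏ _v : Fin m, truncExp k := by simp
  rw [h]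
  simp only [truncExp]
  rw [Finset.prod_univ_sum, Polynomial.finsetSum_coeff, Finset.sum_filter]
  refine Finset.sum_congr rfl fun d _ => ?_
  rw [Finset.prod_mul_distrib, Finset.prod_pow_eq_pow_sum, ← map_prod, Polynomial.coeff_C_mul_X_pow]
  simp only [one_div, Finset.prod_inv_distrib, eq_comm]

/-- The sum of `∏ 1 / dᵢ!` over the compositions `(d₁, …, dₘ)` of `n` with parts at most `k`. -/
noncomputable def compositionSum (k n : ℕ) : ℝ :=
  ∑ m ∈ Finset.range (n + 1), (truncExp k ^ m).coeff n

theorem sum_range_coeff_truncExp_pow (k n M : ℕ) (h : n + 1 ≤ M) :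
    ∑ m ∈ Finset.range M, (truncExp k ^ m).coeff n = compositionSum k n := by
  refine (Finset.sum_subset (by simpa using h) fun m _ hm => ?_).symm
  exact coeff_truncExp_pow_of_lt k (by simpa using hm)

/-- Remove the first part `i` of the composition. -/
theorem compositionSum_rec (k n : ℕ) (hn : 1 ≤ n) :
    compositionSum k n = ∑ i ∈ Finset.Icc 1 k,
      if i ≤ n then 1 / (i.factorial : ℝ) * compositionSum k (n - i) else 0 := by
  rw [compositionSum, Finset.sum_range_succ', pow_zero, Polynomial.coeff_one, if_neg (by omega),
    add_zero]
  simp only [coeff_truncExp_pow_succ]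
  rw [Finset.sum_comm]
  refine Finset.sum_congr rfl fun i hi => ?_
  rw [Finset.mem_Icc] at hi
  split_ifs with hin
  · rw [← Finset.mul_sum, sum_range_coeff_truncExp_pow k (n - i) n (by omega)]
  · simp

theorem compositionSum_zero (k : ℕ) : compositionSum k 0 = 1 := by
  simp [compositionSum]

variable {k : ℕ} {α : ℝ}

/-- By the equation for `α`, `(1/α)^n` satisfies the same recurrence with the terms `i > n` kept,
and those terms are nonnegative. -/
theorem compositionSum_le (h0 : 0 < α)
    (hα : ∑ i ∈ Finset.Icc 1 k, α ^ i / (i.factorial : ℝ) = 1) (n : ℕ) :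
    compositionSum k n ≤ (1 / α) ^ n := by
  induction n using Nat.strong_induction_on with
  | _ n ih =>
    rcases Nat.eq_zero_or_pos n with rfl | hn
    · simp [compositionSum_zero]
    · have hsplit : (1 / α) ^ n =
          ∑ i ∈ Finset.Icc 1 k, (1 / α) ^ n * (α ^ i / (i.factorial : ℝ)) := by
        rw [← Finset.mul_sum, hα, mul_one]
      rw [compositionSum_rec k n hn, hsplit]
      refine Finset.sum_le_sum fun i hi => ?_
      rw [Finset.mem_Icc] at hi
      split_ifs with hin
      · have h1 : (1 / α) ^ n = (1 / α) ^ (n - i) * (1 / α) ^ i := by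
          rw [← pow_add, Nat.sub_add_cancel hin]
        have h2 : (1 / α) ^ n * (α ^ i / (i.factorial : ℝ)) =
            1 / (i.factorial : ℝ) * (1 / α) ^ (n - i) := by
          rw [h1, one_div, inv_pow α i]
          field_simp
        rw [h2]
        exact mul_le_mul_of_nonneg_left (ih _ (by omega)) (by positivity)
      · positivity

theorem one_le_compositionSum (hk : 1 ≤ k) (n : ℕ) : 1 ≤ compositionSum k n := by
  induction n using Nat.strong_induction_on with
  | _ n ih =>
    rcases Nat.eq_zero_or_pos n with rfl | hn
    · rw [compositionSum_zero]
    · rw [compositionSum_rec k n hn]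
      have hnonneg : ∀ i ∈ Finset.Icc 1 k, (0 : ℝ) ≤
          if i ≤ n then 1 / (i.factorial : ℝ) * compositionSum k (n - i) else 0 := by
        intro i hi
        rw [Finset.mem_Icc] at hi
        split_ifs
        · exact mul_nonneg (by positivity) (zero_le_one.trans (ih _ (by omega)))
        · rfl
      refine le_trans ?_ (Finset.single_le_sum hnonneg (Finset.mem_Icc.2 ⟨le_rfl, hk⟩))
      rw [if_pos (by omega)]
      simpa using ih (n - 1) (by omega)

/-- For `n > k` the recurrence is untruncated and is solved by `(1/α)^n`; the factor `α^k` makes the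
bound at most 1 on the initial range `n ≤ k`. -/
theorem le_compositionSum (hk : 1 ≤ k) (h0 : 0 < α) (h1 : α ≤ 1)
    (hα : ∑ i ∈ Finset.Icc 1 k, α ^ i / (i.factorial : ℝ) = 1) (n : ℕ) :
    α ^ k * (1 / α) ^ n ≤ compositionSum k n := by
  induction n using Nat.strong_induction_on with
  | _ n ih =>
    rcases le_or_gt n k with hn | hn
    · refine le_trans ?_ (one_le_compositionSum hk n)
      rw [one_div, inv_pow, ← div_eq_mul_inv]
      exact div_le_one_of_le₀ (pow_le_pow_of_le_one h0.le h1 hn) (by positivity)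
    · have hsplit : α ^ k * (1 / α) ^ n =
          ∑ i ∈ Finset.Icc 1 k, α ^ k * (1 / α) ^ n * (α ^ i / (i.factorial : ℝ)) := by
        rw [← Finset.mul_sum, hα, mul_one]
      rw [compositionSum_rec k n (by omega), hsplit]
      refine Finset.sum_le_sum fun i hi => ?_
      rw [Finset.mem_Icc] at hi
      have hin : i ≤ n := by omega
      rw [if_pos hin]
      have h1 : (1 / α) ^ n = (1 / α) ^ (n - i) * (1 / α) ^ i := by
        rw [← pow_add, Nat.sub_add_cancel hin]
      have h2 : α ^ k * (1 / α) ^ n * (α ^ i / (i.factorial : ℝ)) =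
          1 / (i.factorial : ℝ) * (α ^ k * (1 / α) ^ (n - i)) := by
        rw [h1, one_div, inv_pow α i]
        field_simp
      rw [h2]
      exact mul_le_mul_of_nonneg_left (ih _ (by omega)) (by positivity)

theorem exists_unique_root (hk : 1 ≤ k) :
    ∃ α : ℝ, (0 < α ∧ α ≤ 1) ∧ ∀ x : ℝ, 0 < x → x ≤ 1 →
      ((∑ i ∈ Finset.Icc 1 k, x ^ i / (Nat.factorial i : ℝ)) - 1 = 0 ↔ x = α) := by
  set f : ℝ → ℝ := fun x => ∑ i ∈ Finset.Icc 1 k, x ^ i / (Nat.factorial i : ℝ) with hf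
  have hcont : Continuous f := by fun_prop
  have hne : (Finset.Icc 1 k).Nonempty := ⟨1, Finset.mem_Icc.2 ⟨le_rfl, hk⟩⟩
  have hmono : StrictMonoOn f (Set.Ici 0) := by
    intro x hx y _ hxy
    refine Finset.sum_lt_sum_of_nonempty hne fun i hi => ?_
    rw [Finset.mem_Icc] at hi
    have hx : 0 ≤ x := hx
    exact div_lt_div_of_pos_right (pow_lt_pow_left₀ hxy hx (by omega)) (by positivity)
  have hf0 : f 0 = 0 := Finset.sum_eq_zero fun i hi => by
    rw [Finset.mem_Icc] at hi
    rw [zero_pow (by omega), zero_div]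
  have hf1 : 1 ≤ f 1 := by
    refine le_trans ?_ (Finset.single_le_sum (fun i _ => by positivity)
      (Finset.mem_Icc.2 ⟨le_rfl, hk⟩))
    simp
  obtain ⟨α, hα, hfα⟩ := intermediate_value_Icc zero_le_one hcont.continuousOn
    (show (1 : ℝ) ∈ Set.Icc (f 0) (f 1) from ⟨by rw [hf0]; exact zero_le_one, hf1⟩)
  have hα0 : 0 < α := lt_of_le_of_ne hα.1 fun h => by
    rw [← h, hf0] at hfα
    exact zero_ne_one hfα
  refine ⟨α, ⟨hα0, hα.2⟩, fun x hx _ => ?_⟩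
  rw [sub_eq_zero, ← hfα]
  exact hmono.injOn.eq_iff hx.le hα0.le

end Compositions

/-! ### Sorting normalized systems by degree sequence. -/

/-- The embedding of `Fin m` into `ℕ` with image `{1, …, m}`. -/
def finSuccEmb (m : ℕ) : Fin m ↪ ℕ := ⟨fun i => i + 1, fun i j h => by ext; simpa using h⟩

/-- View a set system on `Fin m` as a set system on `{1, …, m}`. -/
def relabel {m : ℕ} (H : Multiset (Finset (Fin m))) : Multiset (Finset ℕ) :=
  H.map (Finset.map (finSuccEmb m))

theorem relabel_injective (m : ℕ) : Function.Injective (relabel (m := m)) :=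
  Multiset.map_injective (Finset.map_injective _)

theorem mem_vertexSet {H : Multiset (Finset ℕ)} {v : ℕ} : v ∈ vertexSet H ↔ ∃ E ∈ H, v ∈ E := by
  induction H using Multiset.induction_on with
  | empty => simp [vertexSet]
  | cons E H ih =>
    rw [vertexSet] at ih ⊢
    simp [Multiset.sup_cons, ih]

theorem vertexDegree_relabel {m : ℕ} (H : Multiset (Finset (Fin m))) (i : Fin m) :
    vertexDegree (relabel H) (i + 1) = H.countP (fun E => i ∈ E) := by
  rw [vertexDegree, relabel, Multiset.countP_map, Multiset.countP_eq_card_filter]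
  congr 1
  apply Multiset.filter_congr
  intro E _
  exact Finset.mem_map' (finSuccEmb m)

theorem weight_relabel {m : ℕ} (H : Multiset (Finset (Fin m))) :
    weight (relabel H) = ∑ i, H.countP (fun E => i ∈ E) := by
  rw [sum_degree, weight, relabel, Multiset.map_map]
  simp

theorem vertexSet_relabel {m : ℕ} {H : Multiset (Finset (Fin m))}
    (h : ∀ i, 0 < H.countP (fun E => i ∈ E)) : vertexSet (relabel H) = Finset.Icc 1 m := by
  ext v
  rw [mem_vertexSet, Finset.mem_Icc]
  constructor
  · rintro ⟨E, hE, hv⟩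
    obtain ⟨F, -, rfl⟩ := Multiset.mem_map.1 hE
    obtain ⟨i, -, rfl⟩ := Finset.mem_map.1 hv
    change 1 ≤ (i : ℕ) + 1 ∧ (i : ℕ) + 1 ≤ m
    omega
  · rintro ⟨h1, h2⟩
    obtain ⟨F, hF, hi⟩ := Multiset.countP_pos.1 (h ⟨v - 1, by omega⟩)
    refine ⟨F.map (finSuccEmb m), Multiset.mem_map_of_mem _ hF, Finset.mem_map.2 ⟨_, hi, ?_⟩⟩
    change v - 1 + 1 = v
    omega

theorem exists_relabel_eq {m : ℕ} {H : Multiset (Finset ℕ)} (h : vertexSet H ⊆ Finset.Icc 1 m) :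
    ∃ H' : Multiset (Finset (Fin m)), relabel H' = H := by
  refine ⟨H.map fun E => Finset.univ.filter fun i : Fin m => (i : ℕ) + 1 ∈ E, ?_⟩
  rw [relabel, Multiset.map_map]
  conv_rhs => rw [← Multiset.map_id H]
  refine Multiset.map_congr rfl fun E hE => ?_
  ext v
  simp only [Function.comp_apply, Finset.mem_map, Finset.mem_filter, Finset.mem_univ, true_and, id]
  constructor
  · rintro ⟨i, hi, rfl⟩
    exact hi
  · intro hv
    have hv' := Finset.mem_Icc.1 (h (mem_vertexSet.2 ⟨E, hE, hv⟩))
    have hvm : v - 1 + 1 = v := by omega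
    exact ⟨⟨v - 1, by omega⟩, by simpa only [hvm] using hv, hvm⟩

/-- The degree sequences with `m` terms between `1` and `k` and sum `n`. -/
def degreeSequences (k m n : ℕ) : Finset (Fin m → ℕ) :=
  (Fintype.piFinset fun _ : Fin m => Finset.Icc 1 k).filter (fun d => ∑ v, d v = n)

theorem mem_degreeSequences {k m n : ℕ} {d : Fin m → ℕ} :
    d ∈ degreeSequences k m n ↔ (∀ v, 1 ≤ d v ∧ d v ≤ k) ∧ ∑ v, d v = n := by
  simp [degreeSequences, Fintype.mem_piFinset]

theorem le_of_mem_degreeSequences {k m n : ℕ} {d : Fin m → ℕ} (hd : d ∈ degreeSequences k m n) :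
    m ≤ n := by
  rw [mem_degreeSequences] at hd
  rw [← hd.2]
  simpa using Finset.sum_le_sum fun v (_ : v ∈ Finset.univ) => (hd.1 v).1

theorem vertexSet_relabel_of_mem {k m n : ℕ} {d : Fin m → ℕ} (hd : d ∈ degreeSequences k m n)
    {H : Multiset (Finset (Fin m))} (hH : H ∈ degreeSystems d) :
    vertexSet (relabel H) = Finset.Icc 1 m :=
  vertexSet_relabel fun i => by
    rw [hH.2]
    exact ((mem_degreeSequences.1 hd).1 i).1

theorem mem_normalizedSystems_iff {k n : ℕ} {H : Multiset (Finset ℕ)} :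
    H ∈ normalizedSystems k n ↔ ∃ m ∈ Finset.range (n + 1), ∃ d ∈ degreeSequences k m n,
      ∃ H' ∈ degreeSystems d, relabel H' = H := by
  constructor
  · rintro ⟨hs, ⟨m, hm⟩, hw, hk⟩
    obtain ⟨H', rfl⟩ := exists_relabel_eq hm.le
    have hd : (fun i => H'.countP (fun E => i ∈ E)) ∈ degreeSequences k m n := by
      refine mem_degreeSequences.2 ⟨fun i => ?_, (weight_relabel H').symm.trans hw⟩
      have hi : (i : ℕ) + 1 ∈ vertexSet (relabel H') := by
        rw [hm, Finset.mem_Icc]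
        omega
      refine ⟨?_, by rw [← vertexDegree_relabel]; exact hk _ hi⟩
      rw [← vertexDegree_relabel, Nat.succ_le_iff, vertexDegree, Multiset.countP_pos]
      exact mem_vertexSet.1 hi
    refine ⟨m, Finset.mem_range_succ_iff.2 (le_of_mem_degreeSequences hd), _, hd, H', ⟨?_, ?_⟩, rfl⟩
    · intro E hE
      exact Finset.map_nonempty.1 (hs _ (Multiset.mem_map_of_mem _ hE)).1
    · intro v
      rfl
  · rintro ⟨m, -, d, hd, H', hH', rfl⟩
    have hV := vertexSet_relabel_of_mem hd hH'
    rw [mem_degreeSequences] at hd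
    refine ⟨fun E hE => ?_, ⟨m, hV⟩, ?_, fun v hv => ?_⟩
    · refine ⟨?_, fun v hv => (Finset.mem_Icc.1 (hV ▸ mem_vertexSet.2 ⟨E, hE, hv⟩)).1⟩
      obtain ⟨F, hF, rfl⟩ := Multiset.mem_map.1 hE
      exact Finset.map_nonempty.2 (hH'.1 F hF)
    · rw [weight_relabel, ← hd.2]
      exact Finset.sum_congr rfl fun v _ => hH'.2 v
    · rw [hV, Finset.mem_Icc] at hv
      have h := vertexDegree_relabel H' ⟨v - 1, by omega⟩
      rw [hH'.2, show ((⟨v - 1, by omega⟩ : Fin m) : ℕ) + 1 = v from Nat.sub_add_cancel hv.1] at h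
      rw [h]
      exact (hd.1 _).2

/-- The union is disjoint: the vertex set determines `m`, and the system determines its degrees. -/
theorem numSystems_eq_sum (k n : ℕ) :
    numSystems k n = ∑ m ∈ Finset.range (n + 1), ∑ d ∈ degreeSequences k m n,
      (degreeSystems d).ncard := by
  have h : (normalizedSystems_finite k n).toFinset = (Finset.range (n + 1)).biUnion fun m =>
      (degreeSequences k m n).biUnion fun d =>
        (degreeSystems_finite d).toFinset.map ⟨relabel, relabel_injective m⟩ := by
    ext H
    simp only [Set.Finite.mem_toFinset, mem_normalizedSystems_iff, Finset.mem_biUnion,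
      Finset.mem_map, Function.Embedding.coeFn_mk]
  rw [numSystems, Set.ncard_eq_toFinset_card _ (normalizedSystems_finite k n), h,
    Finset.card_biUnion]
  · refine Finset.sum_congr rfl fun m _ => ?_
    rw [Finset.card_biUnion]
    · refine Finset.sum_congr rfl fun d _ => ?_
      rw [Finset.card_map, ← Set.ncard_eq_toFinset_card _ (degreeSystems_finite d)]
    · intro d _ d' _ hne
      rw [Function.onFun, Finset.disjoint_left]
      intro H hH hH'
      simp only [Finset.mem_map, Set.Finite.mem_toFinset, Function.Embedding.coeFn_mk] at hH hH'
      obtain ⟨F, hF, rfl⟩ := hH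
      obtain ⟨F', hF', heq⟩ := hH'
      rw [relabel_injective m heq] at hF'
      exact hne (funext fun v => (hF.2 v).symm.trans (hF'.2 v))
  · intro m _ m' _ hne
    rw [Function.onFun, Finset.disjoint_left]
    intro H hH hH'
    simp only [Finset.mem_biUnion, Finset.mem_map, Set.Finite.mem_toFinset,
      Function.Embedding.coeFn_mk] at hH hH'
    obtain ⟨d, hd, F, hF, rfl⟩ := hH
    obtain ⟨d', hd', F', hF', heq⟩ := hH'
    have h1 := vertexSet_relabel_of_mem hd hF
    rw [← heq, vertexSet_relabel_of_mem hd' hF'] at h1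
    have h2 := congrArg Finset.card h1
    simp only [Nat.card_Icc, Nat.add_sub_cancel] at h2
    exact hne h2.symm

/-! ### Set partitions as systems of maximum degree 1. -/

theorem normalizedSystems_one (n : ℕ) :
    normalizedSystems 1 n = relabel '' degreeSystems fun _ : Fin n => 1 := by
  ext H
  rw [mem_normalizedSystems_iff]
  constructor
  · rintro ⟨m, -, d, hd, H', hH', rfl⟩
    rw [mem_degreeSequences] at hd
    obtain rfl : d = fun _ => 1 := funext fun v => le_antisymm (hd.1 v).2 (hd.1 v).1
    obtain rfl : m = n := by simpa using hd.2
    exact ⟨H', hH', rfl⟩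
  · rintro ⟨H', hH', rfl⟩
    exact ⟨n, by simp, _, mem_degreeSequences.2 ⟨by simp, by simp⟩, H', hH', rfl⟩

theorem range_finpartition_parts (n : ℕ) :
    Set.range (fun P : Finpartition (Finset.Icc 1 n) => P.parts.val) = normalizedSystems 1 n := by
  ext H
  constructor
  · rintro ⟨P, rfl⟩
    refine ⟨fun E hE => ⟨P.nonempty_of_mem_parts hE, fun v hv =>
      (Finset.mem_Icc.1 (P.le hE hv)).1⟩, ⟨n, ?_⟩, ?_, fun v _ => ?_⟩
    · refine Eq.trans ?_ P.sup_parts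
      rw [vertexSet, Finset.sup_def, Multiset.map_id]
    · have h := P.sum_card_parts
      rw [Nat.card_Icc, Nat.add_sub_cancel] at h
      exact h
    · rw [vertexDegree, Multiset.countP_eq_card_filter, ← Finset.filter_val, Finset.card_val,
        Finset.card_le_one]
      intro E hE F hF
      rw [Finset.mem_filter] at hE hF
      exact P.eq_of_mem_parts hE.1 hF.1 hE.2 hF.2
  · intro hH
    have hV : vertexSet H = Finset.Icc 1 n := by
      rw [normalizedSystems_one] at hH
      obtain ⟨H', hH', rfl⟩ := hH
      exact vertexSet_relabel fun i => by rw [hH'.2]; exact one_pos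
    obtain ⟨hs, -, -, hk⟩ := hH
    have hdeg : ∀ v, H.countP (fun E => v ∈ E) ≤ 1 := by
      intro v
      by_cases hv : v ∈ vertexSet H
      · exact hk v hv
      · rw [Multiset.countP_eq_zero.2 fun E hE hvE => hv (mem_vertexSet.2 ⟨E, hE, hvE⟩)]
        exact Nat.zero_le _
    have hnd : H.Nodup := nodup_of_degree_le_one H (fun E hE => (hs E hE).1) hdeg
    refine ⟨⟨⟨H, hnd⟩, ?_, ?_, ?_⟩, rfl⟩
    · rw [Finset.supIndep_iff_pairwiseDisjoint]
      intro E hE F hF hne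
      rw [Function.onFun, id, id, Finset.disjoint_left]
      intro v hvE hvF
      have h1 := hdeg v
      rw [Multiset.countP_eq_card_filter] at h1
      have h2 : (Finset.filter (fun E => v ∈ E) ⟨H, hnd⟩).card ≤ 1 := h1
      rw [Finset.card_le_one] at h2
      exact hne (h2 E (Finset.mem_filter.2 ⟨hE, hvE⟩) F (Finset.mem_filter.2 ⟨hF, hvF⟩))
    · rw [← hV, Finset.sup_def, Multiset.map_id, vertexSet]
    · exact fun h => Finset.not_nonempty_empty (hs _ h).1

theorem bellNumber_eq_ncard (n : ℕ) :
    bellNumber n = (degreeSystems fun _ : Fin n => 1).ncard := by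
  have hinj : Function.Injective (fun P : Finpartition (Finset.Icc 1 n) => P.parts.val) :=
    fun P Q h => Finpartition.ext (Finset.val_injective h)
  rw [← Set.ncard_image_of_injective _ (relabel_injective n), ← normalizedSystems_one,
    ← range_finpartition_parts, ← Set.image_univ, Set.ncard_image_of_injective _ hinj,
    Set.ncard_univ, bellNumber]

theorem dobinski_eq_bellNumber (n : ℕ) : dobinski n = Real.exp 1 * bellNumber n := by
  rw [dobinski_eq_ncard, bellNumber_eq_ncard]

/-! ### Summation over degree sequences and conclusion. -/

theorem sum_inv_prod_factorial (k n : ℕ) :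
    ∑ m ∈ Finset.range (n + 1), ∑ d ∈ degreeSequences k m n, (∏ v, ((d v).factorial : ℝ))⁻¹ =
      compositionSum k n :=
  Finset.sum_congr rfl fun m _ => (coeff_truncExp_pow k m n).symm

theorem exp_mul_numSystems_le (k n : ℕ) (hn : 1024 * (2 * k ^ 2) ^ 2 + 4 ≤ n) :
    Real.exp 1 * numSystems k n ≤ compositionSum k n * (2 * (1 + Real.exp 1) * dobinski n) := by
  rw [numSystems_eq_sum, ← sum_inv_prod_factorial]
  push_cast
  simp only [Finset.mul_sum, Finset.sum_mul]
  refine Finset.sum_le_sum fun m _ => Finset.sum_le_sum fun d hd => ?_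
  have hm := le_of_mem_degreeSequences hd
  rw [mem_degreeSequences] at hd
  have h1 := ncard_degreeSystems_mul_prod_factorial_le d fun v => (hd.1 v).2
  rw [hd.2, Fintype.card_fin, ← le_div_iff₀ (by positivity), div_eq_inv_mul] at h1
  refine h1.trans (mul_le_mul_of_nonneg_left ?_ (by positivity))
  -- All degrees are at least 1, so `m ≤ n` and `2k²m` may be replaced by `K n` with `K = 2k²`.
  refine le_trans (Finset.sum_le_sum fun w _ => ?_) (sum_pow_mul_dobinski_le (2 * k ^ 2) n hn)
  push_cast
  have := dobinski_nonneg (n - 2 * w)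
  gcongr

theorem compositionSum_mul_tsum_shift_le (r n : ℕ) :
    compositionSum (r + 1) n * ∑' M : ℕ, (M : ℝ) ^ n / ((M + r).factorial : ℝ) ≤
      Real.exp 1 * numSystems (r + 1) n := by
  rw [numSystems_eq_sum, ← sum_inv_prod_factorial]
  push_cast
  simp only [Finset.mul_sum, Finset.sum_mul]
  refine Finset.sum_le_sum fun m _ => Finset.sum_le_sum fun d hd => ?_
  rw [mem_degreeSequences] at hd
  have h1 := tsum_shift_le_ncard_degreeSystems d fun v => (hd.1 v).2
  rwa [hd.2, ← div_le_iff₀ (by positivity), div_eq_inv_mul] at h1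

theorem mainTheorem2 (k : ℕ) (hk : 1 ≤ k) :
    ∃ α : ℝ, (0 < α ∧ α ≤ 1) ∧
      (∀ x : ℝ, 0 < x → x ≤ 1 →
        ((∑ i ∈ Finset.Icc 1 k, x ^ i / (Nat.factorial i : ℝ)) - 1 = 0 ↔ x = α)) ∧
      (fun n : ℕ => (Real.log (n : ℝ) / (n : ℝ)) ^ (k - 1) * (1 / α) ^ n * (bellNumber n : ℝ))
        =O[Filter.atTop] (fun n : ℕ => (numSystems k n : ℝ)) ∧
      (fun n : ℕ => (numSystems k n : ℝ))
        =O[Filter.atTop] (fun n : ℕ => (1 / α) ^ n * (bellNumber n : ℝ)) := by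
  obtain ⟨α, ⟨h0, h1⟩, huniq⟩ := exists_unique_root hk
  have hα : ∑ i ∈ Finset.Icc 1 k, α ^ i / (i.factorial : ℝ) = 1 :=
    sub_eq_zero.1 ((huniq α h0 h1).2 rfl)
  have he := Real.exp_pos 1
  refine ⟨α, ⟨h0, h1⟩, huniq, ?_, ?_⟩
  · obtain ⟨r, rfl⟩ : ∃ r, k = r + 1 := ⟨k - 1, by omega⟩
    -- The numerator is the cost of shifting the series; `α^(r+1)` is the loss in
    -- `le_compositionSum`.
    refine IsBigO.of_bound (2 * (3 + r : ℝ) ^ r / α ^ (r + 1)) ?_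
    filter_upwards [eventually_log_div_pow_mul_dobinski_le r] with n hn
    have hlog : 0 ≤ Real.log n := Real.log_natCast_nonneg n
    rw [Nat.add_sub_cancel, Real.norm_of_nonneg (by positivity), Real.norm_of_nonneg (by positivity),
      div_mul_eq_mul_div, le_div_iff₀ (by positivity), ← mul_le_mul_iff_right₀ he]
    have hT : 0 ≤ ∑' M : ℕ, (M : ℝ) ^ n / ((M + r).factorial : ℝ) :=
      tsum_nonneg fun M => by positivity
    calc Real.exp 1 * ((Real.log n / n) ^ r * (1 / α) ^ n * bellNumber n * α ^ (r + 1))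
        = (α ^ (r + 1) * (1 / α) ^ n) * ((Real.log n / n) ^ r * dobinski n) := by
          rw [dobinski_eq_bellNumber]
          ring
      _ ≤ (α ^ (r + 1) * (1 / α) ^ n) * (2 * (3 + r : ℝ) ^ r * _) := by gcongr
      _ ≤ compositionSum (r + 1) n * (2 * (3 + r : ℝ) ^ r *
            ∑' M : ℕ, (M : ℝ) ^ n / ((M + r).factorial : ℝ)) := by
          gcongr
          exact le_compositionSum hk h0 h1 hα n
      _ = 2 * (3 + r : ℝ) ^ r * (compositionSum (r + 1) n *
            ∑' M : ℕ, (M : ℝ) ^ n / ((M + r).factorial : ℝ)) := by ring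
      _ ≤ 2 * (3 + r : ℝ) ^ r * (Real.exp 1 * numSystems (r + 1) n) := by
          exact mul_le_mul_of_nonneg_left (compositionSum_mul_tsum_shift_le r n) (by positivity)
      _ = _ := by ring
  · refine IsBigO.of_bound (2 * (1 + Real.exp 1)) ?_
    filter_upwards [Filter.eventually_ge_atTop (1024 * (2 * k ^ 2) ^ 2 + 4)] with n hn
    rw [Real.norm_of_nonneg (by positivity), Real.norm_of_nonneg (by positivity),
      ← mul_le_mul_iff_right₀ he]
    refine (exp_mul_numSystems_le k n hn).trans ?_
    have hD := dobinski_nonneg n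
    calc compositionSum k n * (2 * (1 + Real.exp 1) * dobinski n)
        ≤ (1 / α) ^ n * (2 * (1 + Real.exp 1) * dobinski n) := by
          gcongr
          exact compositionSum_le h0 hα n
      _ = _ := by
          rw [dobinski_eq_bellNumber]
          ring
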